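/- Let $n\ge 1$ and $\sigma\ge 1$ be integers, and let $a_0\in C^2(\mathbb R^n;\mathbb C)$ and $\phi_0\in C^2(\mathbb R^n;\mathbb R)$ have compact support, with $(a_0,\phi_0)\neq(0,0)$. Consider the Cauchy problem $$\partial_t\phi+\tfrac12|\nabla\phi|^2+|a|^{2\sigma}=0,\quad \phi_{|t=0}=\phi_0;\qquad \partial_t a+\nabla\phi\cdot\nabla a+\tfrac12\,a\,\Delta\phi=0,\quad a_{|t=0}=a_0,$$ for a complex-valued $a$ and a real-valued $\phi$. Then there is no solution $(a,\phi)\in C^2([0,+\infty[\times\mathbb R^n)$. Moreover the lifespan is finite: the supremum of all $T>0$ for which there is a solution $(a,\phi)\in C^2([0,T[\times\mathbb R^n)$ is finite; in particular, if in addition $a_0$ and $\phi_0$ are $C^\infty$ (so that they lie in $H^\infty(\mathbb R^n)=\bigcap_{s>0}H^s(\mathbb R^n)$), the lifespan $T^*$ of the maximal solution $(\phi,a)\in C([0,T^*[;H^\infty(\mathbb R^n))$ is finite. -/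

import Mathlib

open Set Filter Topology MeasureTheory
open scoped ContDiff

noncomputable section

/-- `(a, φ)` is of class `C²` on `I × ℝⁿ` (`I` a time interval starting at `0`) and solves there the
Cauchy problem
`∂ₜφ + ½|∇φ|² + |a|^{2σ} = 0`, `φ(0) = φ₀`, `∂ₜa + ∇φ·∇a + ½ a Δφ = 0`, `a(0) = a₀`.
The amplitude `a` is complex valued, the phase `φ` is real valued. On `I`, which contains `0`,
the regularity is up to the boundary, and the time derivative at `t = 0` is one-sided. -/
structure IsC2Solution {n : ℕ} (σ : ℕ) (I : Set ℝ)
    (a₀ : EuclideanSpace ℝ (Fin n) → ℂ) (φ₀ : EuclideanSpace ℝ (Fin n) → ℝ)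
    (a : ℝ → EuclideanSpace ℝ (Fin n) → ℂ) (φ : ℝ → EuclideanSpace ℝ (Fin n) → ℝ) : Prop where
  contDiffOn_a : ContDiffOn ℝ 2 (fun p : ℝ × EuclideanSpace ℝ (Fin n) => a p.1 p.2) (I ×ˢ univ)
  contDiffOn_φ : ContDiffOn ℝ 2 (fun p : ℝ × EuclideanSpace ℝ (Fin n) => φ p.1 p.2) (I ×ˢ univ)
  eikonal : ∀ t ∈ I, ∀ x,
    derivWithin (fun s => φ s x) I t + (1 / 2 : ℝ) * ‖gradient (φ t) x‖ ^ 2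
      + ‖a t x‖ ^ (2 * σ) = 0
  transport : ∀ t ∈ I, ∀ x,
    derivWithin (fun s => a s x) I t + fderiv ℝ (a t) x (gradient (φ t) x)
      + (1 / 2 : ℂ) * a t x * ((Laplacian.laplacian (φ t) x : ℝ) : ℂ) = 0
  init_a : ∀ x, a 0 x = a₀ x
  init_φ : ∀ x, φ 0 x = φ₀ x

/-- The lifespan of the Cauchy problem in the class of `C²` solutions: the supremum of all `T > 0`
such that a `C²` solution exists on `[0,T[ × ℝⁿ`. -/
def classicalLifespan {n : ℕ} (σ : ℕ)
    (a₀ : EuclideanSpace ℝ (Fin n) → ℂ) (φ₀ : EuclideanSpace ℝ (Fin n) → ℝ) : ENNReal :=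
  ⨆ T ∈ {T : ℝ | 0 < T ∧ ∃ a φ, IsC2Solution σ (Ico 0 T) a₀ φ₀ a φ}, ENNReal.ofReal T

/-- `f ∈ H^∞(ℝⁿ)`: the (smooth representative) function `f` is square integrable with all its
derivatives. -/
def MemHInfty {n : ℕ} {F : Type*} [NormedAddCommGroup F] [NormedSpace ℝ F]
    (f : EuclideanSpace ℝ (Fin n) → F) : Prop :=
  ContDiff ℝ ∞ f ∧ ∀ k : ℕ, MemLp (iteratedFDeriv ℝ k f) 2 volume

/-- `f ∈ C(I; H^∞(ℝⁿ))`: `f` takes its values in `H^∞` and is continuous for each of the seminorms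
`‖∇ᵏ ·‖_{L²}`, that is, for each `H^s` norm. -/
def ContinuousOnHInfty {n : ℕ} {F : Type*} [NormedAddCommGroup F] [NormedSpace ℝ F]
    (f : ℝ → EuclideanSpace ℝ (Fin n) → F) (I : Set ℝ) : Prop :=
  (∀ t ∈ I, MemHInfty (f t)) ∧
    ∀ k : ℕ, ∀ t ∈ I,
      Tendsto (fun s => eLpNorm (iteratedFDeriv ℝ k (fun x => f s x - f t x)) 2 volume)
        (𝓝[I] t) (𝓝 0)

/-- The lifespan of the Cauchy problem in `H^∞`: the supremum of all `T > 0` such that a solution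
exists in `C([0,T[; H^∞(ℝⁿ))`. (Such solutions are automatically classical, the equations giving
the time regularity.) -/
def sobolevLifespan {n : ℕ} (σ : ℕ)
    (a₀ : EuclideanSpace ℝ (Fin n) → ℂ) (φ₀ : EuclideanSpace ℝ (Fin n) → ℝ) : ENNReal :=
  ⨆ T ∈ {T : ℝ | 0 < T ∧ ∃ a φ, IsC2Solution σ (Ico 0 T) a₀ φ₀ a φ ∧
    ContinuousOnHInfty a (Ico 0 T) ∧ ContinuousOnHInfty φ (Ico 0 T)}, ENNReal.ofReal T

end

open Set Filter Topology MeasureTheory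
open scoped ContDiff

/-! With `ρ = ‖a‖²` and `v = ∇φ`, the system becomes a compressible potential flow: `∂ₜρ + div (ρ v)
= 0` and `∂ₜφ + |v|²/2 + ρ^σ = 0`. The phase of `a` plays no role. The blow-up mechanism is that the
vacuum outside the support never moves inwards or outwards, while the flow inside has to disperse.

Confinement (`support_subset`): the entropy `ρ^σ + (σ/2)|v|²` has a flux bounded by `(1 + σ)|v|`
times itself, so signals in a vacuum at rest have zero speed. A weighted energy estimate on a
shrinking ball (`entropy_eq_zero_of_velocity_le`), closed by continuity in time
(`entropy_eq_zero_outside`), keeps `ρ`, `v` and `φ` zero outside the initial ball of radius `R`.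

Positive mass (`lifespan_le_of_mass_pos`): set `F = ∫ φ`, so that `F' = -∫ (|v|²/2 + ρ^σ)`. The mass
is conserved and confined to a fixed ball, so convexity bounds `∫ ρ^σ` below by a positive constant.
Since `φ` is confined too, `F = -∫ (x·e)(v·e)` for a unit vector `e`, and `F²` is controlled by `∫
|v|²`. Hence `F' ≤ -(α + β F²)` with `α, β > 0` fixed by the data, and `lifespan_le_of_riccati`
bounds the lifespan.

Zero mass (`lifespan_le_of_density_eq_zero`): then `ρ` stays zero and `v` is transported along
straight lines. A point with `v ≠ 0` would leave the ball in finite time, against confinement.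

Both bounds depend on the data only, hence apply to all solutions at once
(`exists_forall_lifespan_le`). -/

noncomputable section


/-! ### Integration by parts, and calculus on time slices -/

section Calculus

variable {E : Type*} [NormedAddCommGroup E] [InnerProductSpace ℝ E] [FiniteDimensional ℝ E]
  [MeasurableSpace E] [BorelSpace E]

theorem integral_fderiv_apply_eq_zero {f : E → ℝ} (hf : ContDiff ℝ 1 f)
    (hc : HasCompactSupport f) (v : E) : ∫ x, fderiv ℝ f x v = 0 := by
  have hi : Integrable (fun x => fderiv ℝ f x v) := by
    refine Continuous.integrable_of_hasCompactSupport ?_ (hc.fderiv_apply ℝ v)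
    exact (hf.continuous_fderiv one_ne_zero).clm_apply continuous_const
  have h := integral_mul_fderiv_eq_neg_fderiv_mul_of_integrable (μ := volume)
    (f := fun _ : E => (1 : ℝ)) (g := f) (v := v) (by simp) (by simpa using hi)
    (by simpa using hf.continuous.integrable_of_hasCompactSupport hc)
    (fun x _ => differentiableAt_const _) (fun x _ => hf.differentiable one_ne_zero x)
  simpa using h

omit [MeasurableSpace E] [BorelSpace E] in
theorem laplacian_eq_sum_fderiv_fderiv (φ : E → ℝ) (x : E) :
    Laplacian.laplacian φ x = ∑ i, fderiv ℝ (fderiv ℝ φ) x (stdOrthonormalBasis ℝ E i)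
      (stdOrthonormalBasis ℝ E i) := by
  rw [InnerProductSpace.laplacian_eq_iteratedFDeriv_stdOrthonormalBasis]
  simp [iteratedFDeriv_two_apply]

omit [MeasurableSpace E] [BorelSpace E] in
theorem gradient_eq_sum_fderiv_smul (φ : E → ℝ) (x : E) :
    gradient φ x = ∑ i, fderiv ℝ φ x (stdOrthonormalBasis ℝ E i) • stdOrthonormalBasis ℝ E i := by
  conv_lhs => rw [← (stdOrthonormalBasis ℝ E).sum_repr' (gradient φ x)]
  refine Finset.sum_congr rfl fun i _ => ?_
  rw [real_inner_comm, inner_gradient_left]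

/-- The divergence theorem for the compactly supported field `G ∇φ`. -/
theorem integral_fderiv_gradient_add_mul_laplacian {G φ : E → ℝ} (hG : ContDiff ℝ 1 G)
    (hc : HasCompactSupport G) (hφ : ContDiff ℝ 2 φ) :
    ∫ x, (fderiv ℝ G x (gradient φ x) + G x * Laplacian.laplacian φ x) = 0 := by
  set b := stdOrthonormalBasis ℝ E
  have hd : ContDiff ℝ 1 (fderiv ℝ φ) := hφ.fderiv_right (by norm_num)
  have hdi : ∀ i, ContDiff ℝ 1 (fun x => fderiv ℝ φ x (b i)) := fun i => hd.clm_apply contDiff_const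
  have hF : ∀ i, ContDiff ℝ 1 (fun x => G x * fderiv ℝ φ x (b i)) := fun i => hG.mul (hdi i)
  have hFc : ∀ i, HasCompactSupport (fun x => G x * fderiv ℝ φ x (b i)) := fun i => hc.mul_right
  have key : ∀ x, fderiv ℝ G x (gradient φ x) + G x * Laplacian.laplacian φ x
      = ∑ i, fderiv ℝ (fun x => G x * fderiv ℝ φ x (b i)) x (b i) := by
    intro x
    rw [gradient_eq_sum_fderiv_smul, laplacian_eq_sum_fderiv_fderiv, map_sum, Finset.mul_sum, ← Finset.sum_add_distrib]
    refine Finset.sum_congr rfl fun i _ => ?_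
    have hp := (((hG.differentiable one_ne_zero x).hasFDerivAt).mul
      (((hd.differentiable one_ne_zero x).hasFDerivAt).clm_apply
        (hasFDerivAt_const (b i) x))).fderiv
    have hp' : fderiv ℝ (fun x => G x * fderiv ℝ φ x (b i)) x = _ := hp
    rw [hp']
    simp [b]
    ring
  simp_rw [key]
  rw [integral_finsetSum]
  · exact Finset.sum_eq_zero fun i _ => integral_fderiv_apply_eq_zero (hF i) (hFc i) _
  · intro i _
    refine Continuous.integrable_of_hasCompactSupport ?_ ((hFc i).fderiv_apply ℝ _)
    exact ((hF i).continuous_fderiv one_ne_zero).clm_apply continuous_const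

variable {F : Type*} [NormedAddCommGroup F] [NormedSpace ℝ F]

omit [FiniteDimensional ℝ E] [MeasurableSpace E] [BorelSpace E] in
-- The spatial derivative is the space-time derivative within the slab, restricted to spatial
-- directions. The slab has unique derivatives even at `t = 0`, so regularity holds up to the
-- initial time.
theorem contDiffOn_fderiv_slice {f : ℝ → E → F} {T : ℝ} {k m : ℕ∞} (hkm : (m + 1 : WithTop ℕ∞) ≤ k)
    (hf : ContDiffOn ℝ k (fun p : ℝ × E => f p.1 p.2) (Ico 0 T ×ˢ univ)) :
    ContDiffOn ℝ m (fun p : ℝ × E => fderiv ℝ (f p.1) p.2) (Ico 0 T ×ˢ univ) := by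
  have hu : UniqueDiffOn ℝ (Ico 0 T ×ˢ (univ : Set E)) :=
    (uniqueDiffOn_Ico 0 T).prod uniqueDiffOn_univ
  have h1 := hf.fderivWithin hu hkm
  have h2 : ContDiffOn ℝ m (fun p : ℝ × E => (fderivWithin ℝ (fun p : ℝ × E => f p.1 p.2)
      (Ico 0 T ×ˢ univ) p).comp (ContinuousLinearMap.inr ℝ ℝ E)) (Ico 0 T ×ˢ univ) :=
    h1.clm_comp contDiffOn_const
  refine h2.congr ?_
  rintro ⟨t, x⟩ ht
  have hk : (k : WithTop ℕ∞) ≠ 0 := by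
    intro h
    rw [h] at hkm
    have := le_trans le_add_self hkm
    simp at this
  have h3 := ((hf.differentiableOn hk) (t, x) ht).hasFDerivWithinAt
  have h4 : HasFDerivAt (fun y : E => (t, y)) (ContinuousLinearMap.inr ℝ ℝ E) x :=
    hasFDerivAt_prodMk_right t x
  have h5 := h3.comp (s := univ) x h4.hasFDerivWithinAt (fun y _ => ⟨ht.1, mem_univ _⟩)
  exact (hasFDerivWithinAt_univ.1 h5).fderiv

omit [FiniteDimensional ℝ E] [MeasurableSpace E] [BorelSpace E] in
theorem HasFDerivAt.slice_right {f : ℝ × E → F} {f' : ℝ × E →L[ℝ] F} {t : ℝ} {x : E}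
    (hf : HasFDerivAt f f' (t, x)) :
    HasFDerivAt (fun y => f (t, y)) (f' ∘L ContinuousLinearMap.inr ℝ ℝ E) x :=
  hf.comp x (hasFDerivAt_prodMk_right t x)

omit [FiniteDimensional ℝ E] [MeasurableSpace E] [BorelSpace E] in
theorem HasFDerivAt.slice_left {f : ℝ × E → F} {f' : ℝ × E →L[ℝ] F} {t : ℝ} {x : E}
    (hf : HasFDerivAt f f' (t, x)) : HasDerivAt (fun s => f (s, x)) (f' (1, 0)) t :=
  hf.comp_hasDerivAt t ((hasDerivAt_id t).prodMk (hasDerivAt_const t x))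

omit [InnerProductSpace ℝ E] [FiniteDimensional ℝ E] [MeasurableSpace E] [BorelSpace E] in
theorem prod_univ_mem_nhds [NormedSpace ℝ E] {T t : ℝ} (ht : t ∈ Ioo 0 T) (x : E) :
    Ioo 0 T ×ˢ (univ : Set E) ∈ 𝓝 (t, x) :=
  prod_mem_nhds (Ioo_mem_nhds ht.1 ht.2) univ_mem

omit [FiniteDimensional ℝ E] [MeasurableSpace E] [BorelSpace E] in
theorem hasDerivAt_slice {f : ℝ × E → F} {T : ℝ} (hf : ContDiffOn ℝ 1 f (Ioo 0 T ×ˢ univ))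
    {t : ℝ} (ht : t ∈ Ioo 0 T) (x : E) :
    HasDerivAt (fun s => f (s, x)) (fderiv ℝ f (t, x) (1, 0)) t :=
  ((hf.contDiffAt (prod_univ_mem_nhds ht x)).differentiableAt
    one_ne_zero).hasFDerivAt.slice_left

/-- Differentiation under the integral sign for functions supported in a fixed compact set. -/
theorem hasDerivAt_integral_slice {f : ℝ × E → ℝ} {T : ℝ}
    (hf : ContDiffOn ℝ 1 f (Ioo 0 T ×ˢ univ)) {K : Set E} (hK : IsCompact K)
    (h0 : ∀ t ∈ Ioo 0 T, ∀ x ∉ K, f (t, x) = 0) {t : ℝ} (ht : t ∈ Ioo 0 T) :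
    HasDerivAt (fun s => ∫ x, f (s, x)) (∫ x, deriv (fun s => f (s, x)) t) t := by
  -- Regularity is known only inside the open time interval, so a compact subinterval around `t`
  -- provides the uniform bound `C` on `K` needed for domination.
  obtain ⟨a, ha0, hat⟩ := exists_between ht.1
  obtain ⟨b, htb, hbT⟩ := exists_between ht.2
  have hsub : Icc a b ⊆ Ioo 0 T := fun s hs => ⟨ha0.trans_le hs.1, hs.2.trans_lt hbT⟩
  have ho : IsOpen (Ioo 0 T ×ˢ (univ : Set E)) := isOpen_Ioo.prod isOpen_univ
  have hcd : ContinuousOn (fun p => fderiv ℝ f p (1, 0)) (Ioo 0 T ×ˢ univ) :=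
    (hf.continuousOn_fderiv_of_isOpen ho le_rfl).clm_apply continuousOn_const
  obtain ⟨C, hC⟩ := ((isCompact_Icc (a := a) (b := b)).prod hK).exists_bound_of_continuousOn
    (hcd.mono (prod_mono hsub (subset_univ K)))
  have hder : ∀ s ∈ Ioo 0 T, ∀ x, HasDerivAt (fun s => f (s, x)) (deriv (fun s => f (s, x)) s) s :=
    fun s hs x => (hasDerivAt_slice hf hs x).differentiableAt.hasDerivAt
  have hslice : ∀ s ∈ Ioo 0 T, Continuous (fun x => f (s, x)) := fun s hs =>
    hf.continuousOn.comp_continuous (by fun_prop) (fun x => ⟨hs, mem_univ _⟩)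
  refine (hasDerivAt_integral_of_dominated_loc_of_deriv_le
    (bound := K.indicator fun _ => C) (F := fun s x => f (s, x))
    (F' := fun s x => deriv (fun s => f (s, x)) s) (Icc_mem_nhds hat htb) ?_ ?_ ?_ ?_ ?_ ?_).2
  · filter_upwards [Ioo_mem_nhds ht.1 ht.2] with s hs
    exact (hslice s hs).aestronglyMeasurable
  · refine (hslice t ht).integrable_of_hasCompactSupport (HasCompactSupport.intro hK (h0 t ht))
  · refine Continuous.aestronglyMeasurable ?_
    have : (fun x => deriv (fun s => f (s, x)) t) = fun x => fderiv ℝ f (t, x) (1, 0) :=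
      funext fun x => (hasDerivAt_slice hf ht x).deriv
    rw [this]
    exact hcd.comp_continuous (f := fun x : E => (t, x)) (by fun_prop)
      (fun x => ⟨ht, mem_univ _⟩)
  · refine ae_of_all _ fun x s hs => ?_
    by_cases hx : x ∈ K
    · rw [indicator_of_mem hx, (hasDerivAt_slice hf (hsub hs) x).deriv]
      exact hC (s, x) ⟨hs, hx⟩
    · rw [indicator_of_notMem hx]
      have : (fun s => f (s, x)) =ᶠ[𝓝 s] fun _ => 0 := by
        filter_upwards [Ioo_mem_nhds (hsub hs).1 (hsub hs).2] with r hr using h0 r hr x hx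
      rw [this.deriv_eq]
      simp
  · exact (integrable_indicator_iff hK.measurableSet).2 (integrableOn_const hK.measure_lt_top.ne)
  · exact ae_of_all _ fun x s hs => hder s (hsub hs) x

theorem continuousOn_integral_slice {f : ℝ × E → ℝ} {T : ℝ}
    (hf : ContinuousOn f (Ico 0 T ×ˢ univ)) {K : Set E} (hK : IsCompact K)
    (h0 : ∀ t ∈ Ico 0 T, ∀ x ∉ K, f (t, x) = 0) :
    ContinuousOn (fun s => ∫ x, f (s, x)) (Ico 0 T) := by
  refine continuousOn_integral_of_compact_support (f := fun s x => f (s, x)) hK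
    hf ?_
  intro t x ht hx
  exact h0 t ht x hx

end Calculus


/-! ### Potential flows: momentum equation and entropy identity -/

section Flow

variable {E : Type*} [NormedAddCommGroup E] [InnerProductSpace ℝ E] [FiniteDimensional ℝ E]

/-- A potential compressible flow on `[0,T[ × E` with density `ρ ≥ 0`, velocity `∇φ` and
enthalpy `ρ^σ`; the equations are required at positive times. -/
structure IsPotentialFlow (σ : ℕ) (T : ℝ) (ρ φ : ℝ → E → ℝ) : Prop where
  contDiffOn_density : ContDiffOn ℝ 1 (fun p : ℝ × E => ρ p.1 p.2) (Ico 0 T ×ˢ univ)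
  contDiffOn_phase : ContDiffOn ℝ 2 (fun p : ℝ × E => φ p.1 p.2) (Ico 0 T ×ˢ univ)
  nonneg : ∀ t x, 0 ≤ ρ t x
  eikonal : ∀ t ∈ Ioo 0 T, ∀ x,
    deriv (fun s => φ s x) t = -(1 / 2 * ‖gradient (φ t) x‖ ^ 2 + ρ t x ^ σ)
  continuity : ∀ t ∈ Ioo 0 T, ∀ x, deriv (fun s => ρ s x) t
    = -(fderiv ℝ (ρ t) x (gradient (φ t) x) + ρ t x * Laplacian.laplacian (φ t) x)

/-- The quadratic entropy of the symmetrized system. -/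
def flowEntropy (σ : ℕ) (ρ φ : ℝ → E → ℝ) (t : ℝ) (x : E) : ℝ :=
  ρ t x ^ σ + σ / 2 * ‖gradient (φ t) x‖ ^ 2

namespace IsPotentialFlow

variable {σ : ℕ} {T : ℝ} {ρ φ : ℝ → E → ℝ}

theorem contDiff_density (h : IsPotentialFlow σ T ρ φ) {t : ℝ} (ht : t ∈ Ico 0 T) :
    ContDiff ℝ 1 (ρ t) :=
  h.contDiffOn_density.comp_contDiff (f := fun x : E => (t, x)) (by fun_prop)
    fun x => ⟨ht, mem_univ _⟩

theorem contDiff_phase (h : IsPotentialFlow σ T ρ φ) {t : ℝ} (ht : t ∈ Ico 0 T) :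
    ContDiff ℝ 2 (φ t) :=
  h.contDiffOn_phase.comp_contDiff (f := fun x : E => (t, x)) (by fun_prop)
    fun x => ⟨ht, mem_univ _⟩

theorem contDiffOn_fderiv_phase (h : IsPotentialFlow σ T ρ φ) :
    ContDiffOn ℝ 1 (fun p : ℝ × E => fderiv ℝ (φ p.1) p.2) (Ico 0 T ×ˢ univ) := by
  have h2 : ((2 : ℕ∞) : WithTop ℕ∞) = 2 := rfl
  have := contDiffOn_fderiv_slice (f := φ) (k := 2) (m := 1) (T := T) (by norm_num [h2])
    h.contDiffOn_phase
  exact this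

theorem contDiffOn_velocity (h : IsPotentialFlow σ T ρ φ) :
    ContDiffOn ℝ 1 (fun p : ℝ × E => gradient (φ p.1) p.2) (Ico 0 T ×ˢ univ) := by
  simp_rw [gradient_eq_sum_fderiv_smul]
  refine ContDiffOn.sum fun i _ => ?_
  exact (h.contDiffOn_fderiv_phase.clm_apply contDiffOn_const).smul contDiffOn_const

theorem contDiff_velocity (h : IsPotentialFlow σ T ρ φ) {t : ℝ} (ht : t ∈ Ico 0 T) :
    ContDiff ℝ 1 (gradient (φ t)) :=
  h.contDiffOn_velocity.comp_contDiff (f := fun x : E => (t, x)) (by fun_prop)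
    fun x => ⟨ht, mem_univ _⟩

theorem continuousOn_fderiv_velocity (h : IsPotentialFlow σ T ρ φ) :
    ContinuousOn (fun p : ℝ × E => fderiv ℝ (gradient (φ p.1)) p.2) (Ico 0 T ×ˢ univ) := by
  have h2 : ((1 : ℕ∞) : WithTop ℕ∞) = 1 := rfl
  have := contDiffOn_fderiv_slice (f := fun t => gradient (φ t)) (k := 1) (m := 0) (T := T)
    (by simp) h.contDiffOn_velocity
  exact this.continuousOn

theorem continuousOn_laplacian (h : IsPotentialFlow σ T ρ φ) :
    ContinuousOn (fun p : ℝ × E => Laplacian.laplacian (φ p.1) p.2) (Ico 0 T ×ˢ univ) := by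
  have := contDiffOn_fderiv_slice (f := fun t => fderiv ℝ (φ t)) (k := 1) (m := 0) (T := T)
    (by simp) h.contDiffOn_fderiv_phase
  simp_rw [laplacian_eq_sum_fderiv_fderiv]
  refine continuousOn_finsetSum _ fun i _ => ?_
  exact (this.continuousOn.clm_apply continuousOn_const).clm_apply continuousOn_const

theorem contDiffOn_entropy (h : IsPotentialFlow σ T ρ φ) :
    ContDiffOn ℝ 1 (fun p : ℝ × E => flowEntropy σ ρ φ p.1 p.2) (Ico 0 T ×ˢ univ) :=
  (h.contDiffOn_density.pow σ).add (contDiffOn_const.mul (h.contDiffOn_velocity.norm_sq ℝ))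

theorem entropy_nonneg (h : IsPotentialFlow σ T ρ φ) (t : ℝ) (x : E) :
    0 ≤ flowEntropy σ ρ φ t x :=
  add_nonneg (pow_nonneg (h.nonneg t x) σ) (by positivity)

theorem entropy_eq_zero_iff (h : IsPotentialFlow σ T ρ φ) (hσ : 1 ≤ σ) (t : ℝ) (x : E) :
    flowEntropy σ ρ φ t x = 0 ↔ ρ t x = 0 ∧ gradient (φ t) x = 0 := by
  have hs : (0 : ℝ) < σ / 2 := by positivity
  unfold flowEntropy
  rw [add_eq_zero_iff_of_nonneg (pow_nonneg (h.nonneg t x) σ) (by positivity),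
    pow_eq_zero_iff (by omega), mul_eq_zero_iff_left hs.ne', pow_eq_zero_iff two_ne_zero,
    norm_eq_zero]

theorem hasDerivAt_velocity (h : IsPotentialFlow σ T ρ φ) {t : ℝ} (ht : t ∈ Ioo 0 T) (x : E) :
    HasDerivAt (fun s => gradient (φ s) x) (deriv (fun s => gradient (φ s) x) t) t :=
  (hasDerivAt_slice (h.contDiffOn_velocity.mono (prod_mono Ioo_subset_Ico_self subset_rfl))
    ht x).differentiableAt.hasDerivAt

theorem hasFDerivAt_velocity (h : IsPotentialFlow σ T ρ φ) {t : ℝ} (ht : t ∈ Ico 0 T) (x : E) :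
    HasFDerivAt (gradient (φ t)) (fderiv ℝ (gradient (φ t)) x) x :=
  ((h.contDiff_velocity ht).differentiable one_ne_zero x).hasFDerivAt

theorem hasFDerivAt_density (h : IsPotentialFlow σ T ρ φ) {t : ℝ} (ht : t ∈ Ico 0 T) (x : E) :
    HasFDerivAt (ρ t) (fderiv ℝ (ρ t) x) x :=
  ((h.contDiff_density ht).differentiable one_ne_zero x).hasFDerivAt

theorem hasDerivAt_density (h : IsPotentialFlow σ T ρ φ) {t : ℝ} (ht : t ∈ Ioo 0 T) (x : E) :
    HasDerivAt (fun s => ρ s x) (deriv (fun s => ρ s x) t) t :=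
  (hasDerivAt_slice (h.contDiffOn_density.mono (prod_mono Ioo_subset_Ico_self subset_rfl))
    ht x).differentiableAt.hasDerivAt

theorem hasFDerivAt_density_pow (h : IsPotentialFlow σ T ρ φ) {t : ℝ} (ht : t ∈ Ico 0 T) (x : E) :
    HasFDerivAt (fun y => ρ t y ^ σ) ((σ * ρ t x ^ (σ - 1)) • fderiv ℝ (ρ t) x) x := by
  have := (h.hasFDerivAt_density ht x).pow σ
  simpa using! this

/-- The momentum equation, obtained by differentiating the eikonal equation. -/
theorem inner_deriv_velocity (h : IsPotentialFlow σ T ρ φ) {t : ℝ} (ht : t ∈ Ioo 0 T) (x v : E) :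
    inner ℝ (deriv (fun s => gradient (φ s) x) t) v
      = -(inner ℝ (gradient (φ t) x) (fderiv ℝ (gradient (φ t)) x v)
        + σ * ρ t x ^ (σ - 1) * fderiv ℝ (ρ t) x v) := by
  have htI : t ∈ Ico 0 T := Ioo_subset_Ico_self ht
  set Φ : ℝ × E → ℝ := fun p => φ p.1 p.2
  have hΦ : ContDiffOn ℝ 2 Φ (Ioo 0 T ×ˢ univ) :=
    h.contDiffOn_phase.mono (prod_mono Ioo_subset_Ico_self subset_rfl)
  have hat : ∀ s ∈ Ioo 0 T, ∀ y, ContDiffAt ℝ 2 Φ (s, y) := fun s hs y =>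
    hΦ.contDiffAt (prod_univ_mem_nhds hs y)
  have hD : HasFDerivAt (fderiv ℝ Φ) (fderiv ℝ (fderiv ℝ Φ) (t, x)) (t, x) :=
    (((hat t ht x).fderiv_right (m := 1) (by norm_num)).differentiableAt one_ne_zero).hasFDerivAt
  -- Symmetry of the space-time Hessian exchanges `∂ₜ∇φ` for `∇∂ₜφ`. The eikonal equation then gives
  -- the latter, with no third derivative of `φ`.
  have hsymm : IsSymmSndFDerivAt ℝ Φ (t, x) := (hat t ht x).isSymmSndFDerivAt (by simp)
  have hsp : ∀ s ∈ Ioo 0 T, inner ℝ (gradient (φ s) x) v = fderiv ℝ Φ (s, x) (0, v) := by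
    intro s hs
    rw [inner_gradient_left]
    have h1 : HasFDerivAt Φ (fderiv ℝ Φ (s, x)) (s, x) :=
      ((hat s hs x).differentiableAt two_ne_zero).hasFDerivAt
    have h2 := h1.slice_right
    have h3 : fderiv ℝ (φ s) x = _ := h2.fderiv
    rw [h3]
    simp
  have e1 : HasDerivAt (fun s => inner ℝ (gradient (φ s) x) v)
      (fderiv ℝ (fderiv ℝ Φ) (t, x) (1, 0) (0, v)) t := by
    have h1 : HasDerivAt (fun s => fderiv ℝ Φ (s, x)) (fderiv ℝ (fderiv ℝ Φ) (t, x) (1, 0)) t :=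
      HasFDerivAt.slice_left (F := ℝ × E →L[ℝ] ℝ) hD
    have h2 : HasDerivAt (fun s => fderiv ℝ Φ (s, x) (0, v)) _ t :=
      h1.clm_apply (hasDerivAt_const t (0, v))
    simp only [map_zero, add_zero] at h2
    refine h2.congr_of_eventuallyEq ?_
    filter_upwards [Ioo_mem_nhds ht.1 ht.2] with s hs using hsp s hs
  have e2 : HasDerivAt (fun s => inner ℝ (gradient (φ s) x) v)
      (inner ℝ (deriv (fun s => gradient (φ s) x) t) v) t := by
    simpa using (h.hasDerivAt_velocity ht x).inner ℝ (hasDerivAt_const t v)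
  have e3 : HasFDerivAt (fun y => fderiv ℝ Φ (t, y) (1, 0))
      ((fderiv ℝ (fderiv ℝ Φ) (t, x)).flip (1, 0) ∘L ContinuousLinearMap.inr ℝ ℝ E) x := by
    have h1 := HasFDerivAt.slice_right (F := ℝ × E →L[ℝ] ℝ) hD
    have h2 := h1.clm_apply (hasFDerivAt_const ((1 : ℝ), (0 : E)) x)
    refine h2.congr_fderiv ?_
    ext y
    simp
  have e4 : HasFDerivAt (fun y => fderiv ℝ Φ (t, y) (1, 0))
      (-((1 / 2 : ℝ) • (2 • (innerSL ℝ (gradient (φ t) x)).comp (fderiv ℝ (gradient (φ t)) x))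
        + (σ * ρ t x ^ (σ - 1)) • fderiv ℝ (ρ t) x)) x := by
    have h1 := (((h.hasFDerivAt_velocity htI x).norm_sq.const_mul (1 / 2 : ℝ)).add
      (h.hasFDerivAt_density_pow htI x)).neg
    refine h1.congr_of_eventuallyEq (Eventually.of_forall fun y => ?_)
    have := h.eikonal t ht y
    rw [(hasDerivAt_slice (hΦ.of_le (by norm_num)) ht y).deriv] at this
    simpa using! this
  rw [e2.unique e1, hsymm.eq]
  have := congrArg (fun l => l v) (e3.unique e4)
  simpa using! this

/-- The entropy identity of the symmetrized system. -/
theorem deriv_entropy (h : IsPotentialFlow σ T ρ φ) (hσ : 1 ≤ σ) {t : ℝ} (ht : t ∈ Ioo 0 T)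
    (x : E) :
    deriv (fun s => flowEntropy σ ρ φ s x) t
      = -(fderiv ℝ (fun y => flowEntropy σ ρ φ t y + σ * ρ t y ^ σ) x (gradient (φ t) x)
        + σ * ρ t x ^ σ * Laplacian.laplacian (φ t) x) := by
  have htI : t ∈ Ico 0 T := Ioo_subset_Ico_self ht
  have h1 : HasDerivAt (fun s => flowEntropy σ ρ φ s x) _ t :=
    ((h.hasDerivAt_density ht x).pow σ).add ((h.hasDerivAt_velocity ht x).norm_sq.const_mul (σ / 2 : ℝ))
  have h2 : HasFDerivAt (fun y => flowEntropy σ ρ φ t y + σ * ρ t y ^ σ) _ x :=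
    ((h.hasFDerivAt_density_pow htI x).add
      ((h.hasFDerivAt_velocity htI x).norm_sq.const_mul (σ / 2 : ℝ))).add
      ((h.hasFDerivAt_density_pow htI x).const_mul (σ : ℝ))
  have hp : ρ t x ^ σ = ρ t x ^ (σ - 1) * ρ t x := by
    rw [← pow_succ, Nat.sub_add_cancel hσ]
  rw [h1.deriv, h2.fderiv, h.continuity t ht x, real_inner_comm, h.inner_deriv_velocity ht]
  simp [hp]
  ring

end IsPotentialFlow

end Flow


/-! ### A `C¹` cutoff profile and a Gronwall inequality -/

theorem hasDerivAt_max_zero_sq (s : ℝ) : HasDerivAt (fun s : ℝ => max s 0 ^ 2) (2 * max s 0) s := by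
  rcases lt_trichotomy s 0 with h | h | h
  · rw [max_eq_right h.le, mul_zero]
    refine (hasDerivAt_const s (0 : ℝ)).congr_of_eventuallyEq ?_
    filter_upwards [Iio_mem_nhds h] with r hr
    simp [max_eq_right (le_of_lt (mem_Iio.1 hr))]
  · subst h
    rw [hasDerivAt_iff_isLittleO]
    refine Asymptotics.IsBigO.trans_isLittleO (g := fun x : ℝ => x ^ 2) ?_ ?_
    · refine Asymptotics.IsBigO.of_bound 1 (Eventually.of_forall fun x => ?_)
      simp only [max_self, ne_eq, OfNat.ofNat_ne_zero, not_false_eq_true, zero_pow, sub_zero,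
        mul_zero, smul_zero, norm_pow, Real.norm_eq_abs, sq_abs, one_mul]
      rcases le_total x 0 with h | h
      · rw [max_eq_right h]
        simpa using sq_nonneg x
      · rw [max_eq_left h]
    · simpa using Asymptotics.isLittleO_pow_id (𝕜 := ℝ) one_lt_two
  · rw [max_eq_left h.le]
    refine (by simpa using hasDerivAt_pow 2 s : HasDerivAt (fun s : ℝ => s ^ 2) (2 * s) s)
      |>.congr_of_eventuallyEq ?_
    filter_upwards [Ioi_mem_nhds h] with r hr
    rw [max_eq_left (le_of_lt (mem_Ioi.1 hr))]

theorem contDiff_max_zero_sq : ContDiff ℝ 1 (fun s : ℝ => max s 0 ^ 2) := by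
  rw [contDiff_one_iff_deriv]
  refine ⟨fun s => (hasDerivAt_max_zero_sq s).differentiableAt, ?_⟩
  rw [funext fun s => (hasDerivAt_max_zero_sq s).deriv]
  fun_prop

/-- A differential Gronwall inequality that uses the derivative at interior times only. -/
theorem nonpos_of_deriv_le_mul {Q Q' : ℝ → ℝ} {b C : ℝ} (hc : ContinuousOn Q (Ico 0 b))
    (hd : ∀ t ∈ Ioo 0 b, HasDerivAt Q (Q' t) t) (hle : ∀ t ∈ Ioo 0 b, Q' t ≤ C * Q t)
    (h0 : Q 0 ≤ 0) {t : ℝ} (ht : t ∈ Ico 0 b) : Q t ≤ 0 := by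
  have hanti : AntitoneOn (fun t => Real.exp (-C * t) * Q t) (Ico 0 b) := by
    have hder : ∀ t ∈ Ioo 0 b, HasDerivAt (fun t => Real.exp (-C * t) * Q t)
        (Real.exp (-C * t) * (-C * 1) * Q t + Real.exp (-C * t) * Q' t) t := fun t ht =>
      (((hasDerivAt_id t).const_mul (-C)).exp).mul (hd t ht)
    refine antitoneOn_of_deriv_nonpos (convex_Ico 0 b) (ContinuousOn.mul (by fun_prop) hc) ?_ ?_
    · rw [interior_Ico]
      exact fun t ht => (hder t ht).differentiableAt.differentiableWithinAt
    · rw [interior_Ico]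
      intro t ht
      rw [(hder t ht).deriv]
      have := hle t ht
      have := mul_nonneg (Real.exp_pos (-C * t)).le (sub_nonneg.2 this)
      linarith
  have h1 := hanti ⟨le_rfl, ht.1.trans_lt ht.2⟩ ht ht.1
  simp only [mul_zero, Real.exp_zero, one_mul] at h1
  exact nonpos_of_mul_nonpos_right (h1.trans h0) (Real.exp_pos _)

/-! ### Local energy estimate on a shrinking ball -/

section Cone

variable {E : Type*} [NormedAddCommGroup E] [InnerProductSpace ℝ E] [FiniteDimensional ℝ E]

/-- The cutoff of the shrinking ball `|x - x₀|² < A - κ t`. -/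
def coneCutoff (x₀ : E) (A κ : ℝ) (t : ℝ) (x : E) : ℝ := max (A - κ * t - ‖x - x₀‖ ^ 2) 0 ^ 2

omit [FiniteDimensional ℝ E] in
theorem contDiff_coneCutoff (x₀ : E) (A κ : ℝ) :
    ContDiff ℝ 1 (fun p : ℝ × E => coneCutoff x₀ A κ p.1 p.2) := by
  refine contDiff_max_zero_sq.comp (f := fun p : ℝ × E => A - κ * p.1 - ‖p.2 - x₀‖ ^ 2) ?_
  exact (contDiff_const.sub (contDiff_const.mul contDiff_fst)).sub
    ((contDiff_snd.sub contDiff_const).norm_sq ℝ)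

omit [InnerProductSpace ℝ E] [FiniteDimensional ℝ E] in
theorem hasDerivAt_coneCutoff (x₀ : E) (A κ t : ℝ) (x : E) :
    HasDerivAt (fun s => coneCutoff x₀ A κ s x)
      (-(κ * (2 * max (A - κ * t - ‖x - x₀‖ ^ 2) 0))) t := by
  have h1 : HasDerivAt (fun s => A - κ * s - ‖x - x₀‖ ^ 2) (-κ) t := by
    simpa using (((hasDerivAt_id t).const_mul κ).const_sub A).sub_const (‖x - x₀‖ ^ 2)
  refine ((hasDerivAt_max_zero_sq _).comp t h1).congr_deriv ?_
  ring

omit [FiniteDimensional ℝ E] in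
theorem hasFDerivAt_coneCutoff (x₀ : E) (A κ t : ℝ) (x : E) :
    HasFDerivAt (coneCutoff x₀ A κ t)
      ((-(4 * max (A - κ * t - ‖x - x₀‖ ^ 2) 0)) • innerSL ℝ (x - x₀)) x := by
  have h1 : HasFDerivAt (fun y => A - κ * t - ‖y - x₀‖ ^ 2) (-(2 • innerSL ℝ (x - x₀))) x := by
    have := (((hasFDerivAt_id (𝕜 := ℝ) x).sub_const x₀).norm_sq).const_sub (A - κ * t)
    refine this.congr_fderiv ?_
    ext y
    simp
  refine ((hasDerivAt_max_zero_sq _).comp_hasFDerivAt x h1).congr_fderiv ?_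
  ext y
  simp
  ring

omit [InnerProductSpace ℝ E] [FiniteDimensional ℝ E] in
theorem coneCutoff_nonneg (x₀ : E) (A κ t : ℝ) (x : E) : 0 ≤ coneCutoff x₀ A κ t x := sq_nonneg _

variable [MeasurableSpace E] [BorelSpace E]

namespace IsPotentialFlow

variable {σ : ℕ} {T : ℝ} {ρ φ : ℝ → E → ℝ}

/-- A local energy estimate: a vacuum at rest persists in a ball whose boundary shrinks faster than
the signals in it. -/
theorem entropy_eq_zero_of_velocity_le (h : IsPotentialFlow σ T ρ φ) (hσ : 1 ≤ σ) {x₀ : E}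
    {r κ δ t₁ : ℝ} (ht₁ : t₁ < T) (hr : 0 ≤ r) (hδ : 0 ≤ δ)
    (hκ : 2 * (1 + σ) * r * δ ≤ κ)
    (hv : ∀ t ∈ Ico 0 t₁, ∀ x, ‖x - x₀‖ ^ 2 ≤ r ^ 2 - κ * t → ‖gradient (φ t) x‖ ≤ δ)
    (h0 : ∀ x, ‖x - x₀‖ < r → flowEntropy σ ρ φ 0 x = 0)
    {t : ℝ} (ht : t ∈ Ico 0 t₁) {x : E} (hx : ‖x - x₀‖ ^ 2 < r ^ 2 - κ * t) :
    flowEntropy σ ρ φ t x = 0 := by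
  set e := flowEntropy σ ρ φ
  set ψ := coneCutoff x₀ (r ^ 2) κ
  have hκ0 : 0 ≤ κ := le_trans (by positivity) hκ
  have hK : IsCompact (Metric.closedBall x₀ r) := isCompact_closedBall x₀ r
  have hI : Ico 0 t₁ ⊆ Ico 0 T := Ico_subset_Ico_right ht₁.le
  have hout : ∀ t ∈ Ico 0 t₁, ∀ x ∉ Metric.closedBall x₀ r,
      max (r ^ 2 - κ * t - ‖x - x₀‖ ^ 2) 0 = 0 := by
    intro t ht x hx
    rw [Metric.mem_closedBall, dist_eq_norm, not_le] at hx
    have : r ^ 2 ≤ ‖x - x₀‖ ^ 2 := pow_le_pow_left₀ hr hx.le 2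
    have := mul_nonneg hκ0 ht.1
    exact max_eq_right (by linarith)
  have hψ0 : ∀ t ∈ Ico 0 t₁, ∀ x ∉ Metric.closedBall x₀ r, ψ t x = 0 := by
    intro t ht x hx
    simp only [ψ, coneCutoff, hout t ht x hx]
    norm_num
  have hf : ContDiffOn ℝ 1 (fun p : ℝ × E => e p.1 p.2 * ψ p.1 p.2) (Ico 0 t₁ ×ˢ univ) :=
    (h.contDiffOn_entropy.mono (prod_mono hI subset_rfl)).mul (contDiff_coneCutoff _ _ _).contDiffOn
  have hf0 : ∀ t ∈ Ico 0 t₁, ∀ x ∉ Metric.closedBall x₀ r, e t x * ψ t x = 0 := by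
    intro t ht x hx
    rw [hψ0 t ht x hx, mul_zero]
  have hce : ∀ t ∈ Ico 0 T, ContDiff ℝ 1 (e t) := fun t ht =>
    h.contDiffOn_entropy.comp_contDiff (f := fun x : E => (t, x)) (by fun_prop)
      fun x => ⟨ht, mem_univ _⟩
  have hcψ : ∀ t, ContDiff ℝ 1 (ψ t) := fun t =>
    (contDiff_coneCutoff x₀ (r ^ 2) κ).comp (f := fun x : E => (t, x)) (by fun_prop)
  -- Stopping at `t₁ < T` makes the cylinder compact inside the domain, so `Δφ` is bounded there.
  -- This bound is the Gronwall constant.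
  obtain ⟨C, hC⟩ := ((isCompact_Icc (a := 0) (b := t₁)).prod hK).exists_bound_of_continuousOn
    (h.continuousOn_laplacian.mono (prod_mono (Icc_subset_Ico_right ht₁) (subset_univ _)))
  have hQ0 : ∫ x, e 0 x * ψ 0 x ≤ 0 := by
    refine le_of_eq (integral_eq_zero_of_ae (ae_of_all _ fun x => ?_))
    by_cases hx : ‖x - x₀‖ < r
    · simp [e, h0 x hx]
    · have : r ^ 2 ≤ ‖x - x₀‖ ^ 2 := pow_le_pow_left₀ hr (not_lt.1 hx) 2
      have : ψ 0 x = 0 := by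
        simp only [ψ, coneCutoff]
        rw [max_eq_right (by linarith)]
        norm_num
      simp [this]
  have hQ' : ∀ t ∈ Ioo 0 t₁, ∫ x, deriv (fun s => e s x * ψ s x) t
      ≤ C * ∫ x, e t x * ψ t x := by
    intro t ht
    have htI : t ∈ Ico 0 t₁ := Ioo_subset_Ico_self ht
    have htT : t ∈ Ico 0 T := hI htI
    have htO : t ∈ Ioo 0 T := ⟨ht.1, ht.2.trans ht₁⟩
    set m : E → ℝ := fun x => max (r ^ 2 - κ * t - ‖x - x₀‖ ^ 2) 0
    set g : E → ℝ := fun y => e t y + σ * ρ t y ^ σ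
    have hg : ContDiff ℝ 1 g := (hce t htT).add (contDiff_const.mul ((h.contDiff_density htT).pow σ))
    have hG : ContDiff ℝ 1 (fun x => ψ t x * g x) := (hcψ t).mul hg
    have hGc : HasCompactSupport (fun x => ψ t x * g x) :=
      HasCompactSupport.intro hK fun x hx => by rw [hψ0 t htI x hx, zero_mul]
    have hvc : Continuous (gradient (φ t)) := (h.contDiff_velocity htT).continuous
    have hΔc : Continuous (Laplacian.laplacian (φ t)) :=
      h.continuousOn_laplacian.comp_continuous (f := fun x : E => (t, x)) (by fun_prop)
        fun x => ⟨htT, mem_univ _⟩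
    -- `J` is the divergence of `ψ g ∇φ` and integrates to zero. The remainder `R` contains no
    -- derivative of the entropy or of the density.
    set J : E → ℝ := fun x => fderiv ℝ (fun x => ψ t x * g x) x (gradient (φ t) x)
      + ψ t x * g x * Laplacian.laplacian (φ t) x
    set R : E → ℝ := fun x => -(κ * (2 * m x)) * e t x
      - 4 * m x * inner ℝ (x - x₀) (gradient (φ t) x) * g x
      + ψ t x * e t x * Laplacian.laplacian (φ t) x
    have hmc : Continuous m := by fun_prop
    have hec := (hce t htT).continuous
    have hψc := (hcψ t).continuous
    have hgc := hg.continuous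
    have hJi : Integrable J := by
      refine Continuous.integrable_of_hasCompactSupport ?_ ?_
      · exact ((hG.continuous_fderiv one_ne_zero).clm_apply hvc).add (hG.continuous.mul hΔc)
      · exact HasCompactSupport.add ((hGc.fderiv ℝ).mono fun x hx hx' => hx (by simp [hx']))
          hGc.mul_right
    have hRi : Integrable R := by
      refine Continuous.integrable_of_hasCompactSupport (by fun_prop) ?_
      refine HasCompactSupport.intro hK fun x hx => ?_
      simp only [R, m, hout t htI x hx, hψ0 t htI x hx]
      ring
    have hpt : ∀ x, deriv (fun s => e s x * ψ s x) t = R x - J x := by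
      intro x
      have h1 : HasDerivAt (fun s => e s x) (deriv (fun s => e s x) t) t :=
        (hasDerivAt_slice (h.contDiffOn_entropy.mono (prod_mono Ioo_subset_Ico_self subset_rfl))
          htO x).differentiableAt.hasDerivAt
      have h2 : HasDerivAt (fun s => e s x * ψ s x) _ t :=
        h1.mul (hasDerivAt_coneCutoff x₀ (r ^ 2) κ t x)
      have h3 : HasFDerivAt (fun x => ψ t x * g x) _ x :=
        (hasFDerivAt_coneCutoff x₀ (r ^ 2) κ t x).mul
          (hg.differentiable one_ne_zero x).hasFDerivAt
      simp only [J, R]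
      rw [h2.deriv, h3.fderiv, h.deriv_entropy hσ htO x]
      simp only [add_apply, smul_apply,
        innerSL_apply_apply, smul_eq_mul]
      simp only [g, ψ, m]
      ring
    -- The shrinking of the ball contributes `-2κ m e`. The flux through the cutoff is at most `4 m
    -- r δ (1 + σ) e`, since `g ≤ (1 + σ) e`; the condition on `κ` absorbs it, leaving the term in
    -- `Δφ`.
    have hRle : ∀ x, R x ≤ C * (e t x * ψ t x) := by
      intro x
      have he : 0 ≤ e t x := h.entropy_nonneg t x
      by_cases hx : ‖x - x₀‖ ^ 2 ≤ r ^ 2 - κ * t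
      · have hm : 0 ≤ m x := le_max_right _ _
        have hψn : 0 ≤ ψ t x := coneCutoff_nonneg _ _ _ _ _
        have hxr : ‖x - x₀‖ ≤ r := by
          have := mul_nonneg hκ0 htI.1
          exact abs_le_of_sq_le_sq' (by linarith) hr |>.2
        have hlap : Laplacian.laplacian (φ t) x ≤ C :=
          (le_abs_self _).trans (hC (t, x) ⟨⟨ht.1.le, ht.2.le⟩, by
            rwa [Metric.mem_closedBall, dist_eq_norm]⟩)
        have hin : -inner ℝ (x - x₀) (gradient (φ t) x) ≤ r * δ :=
          (neg_le_abs _).trans ((abs_real_inner_le_norm _ _).trans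
            (mul_le_mul hxr (hv t htI x hx) (norm_nonneg _) hr))
        have hg0 : 0 ≤ g x := add_nonneg he (mul_nonneg (Nat.cast_nonneg σ)
          (pow_nonneg (h.nonneg t x) σ))
        have hge : g x ≤ (1 + σ) * e t x := by
          have : ρ t x ^ σ ≤ e t x := le_add_of_nonneg_right (by positivity)
          have := mul_le_mul_of_nonneg_left this (Nat.cast_nonneg (α := ℝ) σ)
          simp only [g]
          linarith
        have a1 := mul_le_mul_of_nonneg_left hlap (mul_nonneg hψn he)
        have a2 := mul_le_mul_of_nonneg_left hin (mul_nonneg (mul_nonneg zero_le_four hm) hg0)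
        have a3 := mul_le_mul_of_nonneg_left hge
          (mul_nonneg (mul_nonneg zero_le_four hm) (mul_nonneg hr hδ))
        have a4 := mul_le_mul_of_nonneg_left hκ (mul_nonneg (mul_nonneg zero_le_two hm) he)
        simp only [R]
        linarith
      · have hm : m x = 0 := max_eq_right (by linarith)
        have hψ' : ψ t x = 0 := by
          change m x ^ 2 = 0
          rw [hm]
          norm_num
        simp [R, hm, hψ']
    calc ∫ x, deriv (fun s => e s x * ψ s x) t = ∫ x, R x := by
          simp_rw [hpt]
          rw [integral_sub hRi hJi,
            integral_fderiv_gradient_add_mul_laplacian hG hGc (h.contDiff_phase htT), sub_zero]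
      _ ≤ ∫ x, C * (e t x * ψ t x) := by
          refine integral_mono hRi ?_ hRle
          refine (((hec.mul hψc).integrable_of_hasCompactSupport ?_)).const_mul C
          exact HasCompactSupport.intro hK (hf0 t htI)
      _ = C * ∫ x, e t x * ψ t x := integral_const_mul _ _
  have hQ := nonpos_of_deriv_le_mul (Q := fun t => ∫ x, e t x * ψ t x)
    (continuousOn_integral_slice hf.continuousOn hK hf0)
    (fun t ht => hasDerivAt_integral_slice (hf.mono (prod_mono Ioo_subset_Ico_self subset_rfl)) hK
      (fun t ht => hf0 t (Ioo_subset_Ico_self ht)) ht) hQ' hQ0 ht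
  have hn : 0 ≤ fun x => e t x * ψ t x := fun x =>
    mul_nonneg (h.entropy_nonneg t x) (coneCutoff_nonneg _ _ _ _ _)
  have hcont : Continuous fun x => e t x * ψ t x :=
    (hce t (hI ht)).continuous.mul (hcψ t).continuous
  -- A continuous nonnegative function with nonpositive integral vanishes; inside the cone the
  -- cutoff is positive, so the entropy itself is zero.
  have hz := (hcont.integral_pos_of_hasCompactSupport_nonneg_nonzero (μ := volume) (x := x)
    (HasCompactSupport.intro hK (hf0 t ht)) hn).mt (not_lt.2 hQ)
  rw [not_ne_iff, mul_eq_zero] at hz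
  refine hz.resolve_right (ne_of_gt ?_)
  have : 0 < r ^ 2 - κ * t - ‖x - x₀‖ ^ 2 := by linarith
  exact pow_pos (lt_max_of_lt_left this) 2

end IsPotentialFlow

end Cone


/-! ### Scalar differential relations: constancy and Riccati blow-up -/

theorem eq_of_hasDerivAt_zero {Q : ℝ → ℝ} {b : ℝ} (hc : ContinuousOn Q (Ico 0 b))
    (hd : ∀ t ∈ Ioo 0 b, HasDerivAt Q 0 t) {t : ℝ} (ht : t ∈ Ico 0 b) : Q t = Q 0 := by
  have h1 := nonpos_of_deriv_le_mul (Q := fun t => Q t - Q 0) (Q' := fun _ => 0) (C := 0)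
    (hc.sub continuousOn_const) (fun t ht => (hd t ht).sub_const _) (by simp) (by simp) ht
  have h2 := nonpos_of_deriv_le_mul (Q := fun t => Q 0 - Q t) (Q' := fun _ => 0) (C := 0)
    (continuousOn_const.sub hc) (fun t ht => by simpa using (hd t ht).const_sub (Q 0))
    (by simp) (by simp) ht
  linarith

/-- A solution of the Riccati inequality `F' ≤ -(α + β F²)` lives at most for the time
`π / √(α β)`. -/
theorem lifespan_le_of_riccati {F F' : ℝ → ℝ} {T α β : ℝ} (hα : 0 < α) (hβ : 0 < β)
    (hd : ∀ t ∈ Ioo 0 T, HasDerivAt F (F' t) t)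
    (hle : ∀ t ∈ Ioo 0 T, F' t ≤ -(α + β * F t ^ 2)) : T ≤ Real.pi / √(α * β) := by
  -- This scaling turns the Riccati inequality into `(arctan (c F))' ≤ -c α`. As `arctan` ranges
  -- over an interval of length `π`, the time available is at most `π / (c α)`.
  set c := √(β / α)
  have hc2 : c ^ 2 * α = β := by
    rw [Real.sq_sqrt (by positivity)]
    field_simp
  have hc : 0 < c := Real.sqrt_pos.2 (by positivity)
  have hk : √(α * β) = c * α := by
    rw [← hc2, show α * (c ^ 2 * α) = (c * α) ^ 2 by ring]
    exact Real.sqrt_sq (by positivity)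
  rw [hk]
  have hk0 : 0 < c * α := by positivity
  have hanti : AntitoneOn (fun t => Real.arctan (c * F t) + c * α * t) (Ioo 0 T) := by
    have hder : ∀ t ∈ Ioo 0 T, HasDerivAt (fun t => Real.arctan (c * F t) + c * α * t)
        (1 / (1 + (c * F t) ^ 2) * (c * F' t) + c * α * 1) t := fun t ht =>
      (((hd t ht).const_mul c).arctan).add ((hasDerivAt_id t).const_mul (c * α))
    refine antitoneOn_of_deriv_nonpos (convex_Ioo 0 T)
      (fun t ht => (hder t ht).continuousAt.continuousWithinAt) ?_ ?_
    · rw [interior_Ioo]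
      exact fun t ht => (hder t ht).differentiableAt.differentiableWithinAt
    · rw [interior_Ioo]
      intro t ht
      rw [(hder t ht).deriv]
      have h1 : 0 < 1 + (c * F t) ^ 2 := by positivity
      have h2 : c * F' t ≤ -(c * α) * (1 + (c * F t) ^ 2) := by
        have := mul_le_mul_of_nonneg_left (hle t ht) hc.le
        calc c * F' t ≤ c * -(α + β * F t ^ 2) := this
          _ = _ := by rw [← hc2]; ring
      have h3 := (div_le_iff₀ h1).2 h2
      rw [one_div, inv_mul_eq_div]
      linarith
  by_contra! hT
  set d := Real.pi / (c * α)
  have hd0 : 0 < d := div_pos Real.pi_pos hk0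
  have hs : (T - d) / 2 ∈ Ioo 0 T := ⟨by linarith, by linarith⟩
  have hs' : (T - d) / 2 + d ∈ Ioo 0 T := ⟨by linarith, by linarith⟩
  have h1 := hanti hs hs' (by linarith)
  have h2 : c * α * d = Real.pi := mul_div_cancel₀ _ hk0.ne'
  have h3 := Real.arctan_lt_pi_div_two (c * F ((T - d) / 2))
  have h4 := Real.neg_pi_div_two_lt_arctan (c * F ((T - d) / 2 + d))
  simp only [mul_add, h2] at h1
  linarith

/-! ### Confinement of the support and conservation of mass -/

section Blowup

variable {E : Type*} [NormedAddCommGroup E] [InnerProductSpace ℝ E] [FiniteDimensional ℝ E]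
  [MeasurableSpace E] [BorelSpace E]

namespace IsPotentialFlow

variable {σ : ℕ} {T : ℝ} {ρ φ : ℝ → E → ℝ}

/-- The exterior vacuum does not shrink: signals have zero speed at its boundary. -/
theorem entropy_eq_zero_outside (h : IsPotentialFlow σ T ρ φ) (hσ : 1 ≤ σ) {R : ℝ}
    (h0 : ∀ x, R < ‖x‖ → flowEntropy σ ρ φ 0 x = 0) {t : ℝ} (ht : t ∈ Ico 0 T) {x₀ : E}
    (hx₀ : R < ‖x₀‖) : flowEntropy σ ρ φ t x₀ = 0 := by
  have hT : 0 < T := ht.1.trans_lt ht.2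
  obtain ⟨t₁, htt₁, ht₁⟩ := exists_between ht.2
  -- Half the gap keeps the closed ball around `x₀` in the initial vacuum. Next, `κ` is small enough
  -- that `x₀` stays in the cone up to time `T`, and `δ` is the largest velocity bound the energy
  -- estimate allows for this `κ`.
  set r := (‖x₀‖ - R) / 2 with hrdef
  have hr : 0 < r := by linarith
  set κ := r ^ 2 / (2 * T) with hκdef
  have hκ0 : 0 < κ := by positivity
  set δ := κ / (2 * (1 + σ) * r) with hδdef
  have hδ : 0 < δ := by positivity
  have hκδ : 2 * (1 + σ) * r * δ ≤ κ := (mul_div_cancel₀ _ (by positivity)).le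
  have hball : ∀ y, ‖y - x₀‖ ≤ r → flowEntropy σ ρ φ 0 y = 0 := by
    intro y hy
    refine h0 y ?_
    have := norm_sub_norm_le x₀ y
    rw [norm_sub_rev] at this
    linarith
  have hvel : ∀ s ∈ Ico 0 t₁, ∀ y, ‖y - x₀‖ ^ 2 ≤ r ^ 2 - κ * s → ‖gradient (φ s) y‖ ≤ δ := by
    by_contra! hcon
    obtain ⟨s, hs, y, hy, hsy⟩ := hcon
    have hsub : Icc 0 t₁ ×ˢ Metric.closedBall x₀ r ⊆ Ico 0 T ×ˢ (univ : Set E) :=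
      prod_mono (Icc_subset_Ico_right ht₁) (subset_univ _)
    have hin : ∀ s y, 0 ≤ s → ‖y - x₀‖ ^ 2 ≤ r ^ 2 - κ * s → ‖y - x₀‖ ≤ r := by
      intro s y hs hy
      have := mul_nonneg hκ0.le hs
      exact (abs_le_of_sq_le_sq' (by linarith) hr.le).2
    -- The points of the closed cone where the velocity bound is reached or exceeded. This set is
    -- compact, so if nonempty it has a point `(s₀, y₀)` of earliest time. Before `s₀` the energy
    -- estimate applies and gives zero velocity at `y₀`, which contradicts continuity at `s₀`.
    set Z : Set (ℝ × E) := Icc 0 t₁ ×ˢ Metric.closedBall x₀ r ∩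
      (fun p : ℝ × E => (‖gradient (φ p.1) p.2‖, r ^ 2 - κ * p.1 - ‖p.2 - x₀‖ ^ 2)) ⁻¹'
        (Ici δ ×ˢ Ici 0)
    have hcc : IsCompact (Icc 0 t₁ ×ˢ Metric.closedBall x₀ r) :=
      isCompact_Icc.prod (isCompact_closedBall x₀ r)
    have hZ : IsCompact Z := by
      refine hcc.of_isClosed_subset (ContinuousOn.preimage_isClosed_of_isClosed ?_ hcc.isClosed
        (isClosed_Ici.prod isClosed_Ici)) inter_subset_left
      exact ((h.contDiffOn_velocity.continuousOn.mono hsub).norm).prodMk (by fun_prop)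
    have hZne : Z.Nonempty := ⟨(s, y), ⟨⟨hs.1, hs.2.le⟩, by
      rw [Metric.mem_closedBall, dist_eq_norm]; exact hin s y hs.1 hy⟩, hsy.le, by
        simpa using hy⟩
    obtain ⟨⟨s₀, y₀⟩, ⟨⟨hs₀, -⟩, hvy, hsy₀⟩, hmin⟩ :=
      hZ.exists_isMinOn hZne continuous_fst.continuousOn
    simp only [mem_Ici] at hvy hsy₀
    have hs₀pos : 0 < s₀ := by
      refine lt_of_le_of_ne hs₀.1 fun heq => ?_
      have hy0 := hball y₀ (hin s₀ y₀ hs₀.1 (by linarith))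
      rw [h.entropy_eq_zero_iff hσ, heq] at hy0
      rw [hy0.2, norm_zero] at hvy
      linarith
    have hs₀T : s₀ < T := hs₀.2.trans_lt ht₁
    have hcone : ∀ τ ∈ Ico 0 s₀, flowEntropy σ ρ φ τ y₀ = 0 := by
      intro τ hτ
      refine h.entropy_eq_zero_of_velocity_le hσ hs₀T hr.le hδ.le hκδ ?_
        (fun x hx => hball x hx.le) hτ ?_
      · intro τ hτ x hx
        by_contra! hlt
        have hmem : (τ, x) ∈ Z := ⟨⟨⟨hτ.1, hτ.2.le.trans hs₀.2⟩, by
          rw [Metric.mem_closedBall, dist_eq_norm]; exact hin τ x hτ.1 hx⟩, hlt.le, by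
            simpa using hx⟩
        exact absurd (hmin hmem) (not_le.2 hτ.2)
      · have := mul_lt_mul_of_pos_left hτ.2 hκ0
        linarith
    have hlim : Tendsto (fun τ => gradient (φ τ) y₀) (𝓝[<] s₀) (𝓝 (gradient (φ s₀) y₀)) :=
      (h.hasDerivAt_velocity ⟨hs₀pos, hs₀T⟩ y₀).continuousAt.mono_left nhdsWithin_le_nhds
    have hlim0 : Tendsto (fun τ => gradient (φ τ) y₀) (𝓝[<] s₀) (𝓝 0) := by
      refine tendsto_const_nhds.congr' ?_
      filter_upwards [Ico_mem_nhdsLT hs₀pos] with τ hτ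
      exact (((h.entropy_eq_zero_iff hσ τ y₀).1 (hcone τ hτ)).2).symm
    rw [tendsto_nhds_unique hlim hlim0, norm_zero] at hvy
    linarith
  refine h.entropy_eq_zero_of_velocity_le hσ ht₁ hr.le hδ.le hκδ hvel
    (fun x hx => hball x hx.le) ⟨ht.1, htt₁⟩ ?_
  have h1 : κ * t < κ * T := mul_lt_mul_of_pos_left ht.2 hκ0
  have h2 : κ * T = r ^ 2 / 2 := by
    rw [hκdef]
    field_simp
  have h3 : 0 < r ^ 2 := by positivity
  simp only [sub_self, norm_zero]
  linarith

/-- Flows issued from data supported in the ball of radius `R` stay supported there. -/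
theorem support_subset (h : IsPotentialFlow σ T ρ φ) (hσ : 1 ≤ σ) {R : ℝ}
    (hρ0 : ∀ x, R < ‖x‖ → ρ 0 x = 0) (hφ0 : ∀ x, R < ‖x‖ → φ 0 x = 0) {t : ℝ}
    (ht : t ∈ Ico 0 T) {x : E} (hx : R < ‖x‖) :
    ρ t x = 0 ∧ gradient (φ t) x = 0 ∧ φ t x = 0 := by
  have hgrad : ∀ x, R < ‖x‖ → gradient (φ 0) x = 0 := by
    intro x hx
    have : φ 0 =ᶠ[𝓝 x] fun _ => 0 := by
      filter_upwards [(isOpen_lt continuous_const continuous_norm).mem_nhds hx] with y hy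
        using hφ0 y hy
    rw [gradient, this.fderiv_eq]
    simp
  have hz : ∀ t ∈ Ico 0 T, ρ t x = 0 ∧ gradient (φ t) x = 0 := fun t ht =>
    (h.entropy_eq_zero_iff hσ t x).1 (h.entropy_eq_zero_outside hσ
      (fun y hy => (h.entropy_eq_zero_iff hσ 0 y).2 ⟨hρ0 y hy, hgrad y hy⟩) ht hx)
  refine ⟨(hz t ht).1, (hz t ht).2, ?_⟩
  rw [← hφ0 x hx]
  refine eq_of_hasDerivAt_zero (Q := fun t => φ t x) ?_ (fun s hs => ?_) ht
  · exact h.contDiffOn_phase.continuousOn.comp (f := fun t : ℝ => (t, x)) (by fun_prop)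
      fun s hs => ⟨hs, mem_univ _⟩
  · have h1 : HasDerivAt (fun s => φ s x) (deriv (fun s => φ s x) s) s :=
      (hasDerivAt_slice ((h.contDiffOn_phase.of_le (by norm_num)).mono
        (prod_mono Ioo_subset_Ico_self subset_rfl)) hs x).differentiableAt.hasDerivAt
    obtain ⟨h2, h3⟩ := hz s (Ioo_subset_Ico_self hs)
    rw [h.eikonal s hs x, h2, h3] at h1
    simpa [show σ ≠ 0 by omega] using h1

/-- Conservation of mass. -/
theorem integral_density (h : IsPotentialFlow σ T ρ φ) {K : Set E} (hK : IsCompact K)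
    (hsupp : ∀ t ∈ Ico 0 T, ∀ x ∉ K, ρ t x = 0) {t : ℝ} (ht : t ∈ Ico 0 T) :
    ∫ x, ρ t x = ∫ x, ρ 0 x := by
  refine eq_of_hasDerivAt_zero (Q := fun t => ∫ x, ρ t x)
    (continuousOn_integral_slice h.contDiffOn_density.continuousOn hK hsupp) (fun s hs => ?_) ht
  refine (hasDerivAt_integral_slice (h.contDiffOn_density.mono
    (prod_mono Ioo_subset_Ico_self subset_rfl)) hK
    (fun t ht => hsupp t (Ioo_subset_Ico_self ht)) hs).congr_deriv ?_
  have hsI := Ioo_subset_Ico_self hs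
  simp only [h.continuity s hs, integral_neg]
  rw [integral_fderiv_gradient_add_mul_laplacian (h.contDiff_density hsI)
    (HasCompactSupport.intro hK (hsupp s hsI)) (h.contDiff_phase hsI), neg_zero]

end IsPotentialFlow

end Blowup


/-! ### Lifespan bounds with and without mass -/

section Lifespan

variable {E : Type*} [NormedAddCommGroup E] [InnerProductSpace ℝ E] [FiniteDimensional ℝ E]

/-- Bernoulli's inequality for `a / m`: convexity in tangent-line form. Taken at the mean density
`m`, it replaces Jensen's inequality. -/
theorem pow_tangent_le {m a : ℝ} (hm : 0 < m) (ha : 0 ≤ a) {σ : ℕ} :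
    m ^ σ + σ * (m ^ σ / m) * (a - m) ≤ a ^ σ := by
  have h1 : -2 ≤ (a / m - 1) := by
    have : 0 ≤ a / m := by positivity
    linarith
  have h2 := one_add_mul_le_pow h1 σ
  rw [add_sub_cancel, div_pow, le_div_iff₀ (by positivity)] at h2
  refine le_trans (le_of_eq ?_) h2
  field_simp

namespace IsPotentialFlow

variable {σ : ℕ} {T : ℝ} {ρ φ : ℝ → E → ℝ}

theorem inner_fderiv_velocity_comm (h : IsPotentialFlow σ T ρ φ) {t : ℝ} (ht : t ∈ Ico 0 T)
    (x v w : E) : inner ℝ (fderiv ℝ (gradient (φ t)) x v) w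
      = inner ℝ (fderiv ℝ (gradient (φ t)) x w) v := by
  have hd : HasFDerivAt (fderiv ℝ (φ t)) (fderiv ℝ (fderiv ℝ (φ t)) x) x :=
    ((((h.contDiff_phase ht).fderiv_right (m := 1) (by norm_num)).differentiable
      one_ne_zero) x).hasFDerivAt
  have key : ∀ v w, inner ℝ (fderiv ℝ (gradient (φ t)) x v) w
      = fderiv ℝ (fderiv ℝ (φ t)) x v w := by
    intro v w
    have h1 : HasFDerivAt (fun y => inner ℝ (gradient (φ t) y) w) _ x :=
      (h.hasFDerivAt_velocity ht x).inner ℝ (hasFDerivAt_const w x)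
    have h2 : HasFDerivAt (fun y => fderiv ℝ (φ t) y w) _ x :=
      hd.clm_apply (hasFDerivAt_const w x)
    simp only [inner_gradient_left] at h1
    have := congrArg (fun l => l v) (h1.unique h2)
    simpa using! this
  rw [key, key]
  exact ((h.contDiff_phase ht).contDiffAt.isSymmSndFDerivAt (by simp)).eq v w

/-- Without density the velocity is constant along straight characteristics. -/
theorem velocity_eq_of_density_eq_zero (h : IsPotentialFlow σ T ρ φ)
    (hρ : ∀ t ∈ Ico 0 T, ∀ x, ρ t x = 0) {t : ℝ} (ht : t ∈ Ico 0 T) (x : E) :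
    gradient (φ t) (x + t • gradient (φ 0) x) = gradient (φ 0) x := by
  obtain ⟨t₁, htt₁, ht₁⟩ := exists_between ht.2
  set v₀ := gradient (φ 0) x
  set V : ℝ × E → E := fun p => gradient (φ p.1) p.2
  have hV : ContDiffOn ℝ 1 V (Ico 0 T ×ˢ univ) := h.contDiffOn_velocity
  have hcurve : ∀ b ≤ T, ∀ s ∈ Ico 0 b, (s, x + s • v₀) ∈ Ico 0 T ×ˢ (univ : Set E) :=
    fun b hb s hs => ⟨⟨hs.1, hs.2.trans_le hb⟩, mem_univ _⟩
  have hcont : Continuous fun s : ℝ => (s, x + s • v₀) := by fun_prop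
  obtain ⟨C, hC⟩ := (isCompact_Icc (a := 0) (b := t₁)).exists_bound_of_continuousOn
    (h.continuousOn_fderiv_velocity.comp hcont.continuousOn
      (fun s hs => ⟨⟨hs.1, hs.2.trans_lt ht₁⟩, mem_univ _⟩))
  have hd : ∀ s ∈ Ioo 0 t₁, HasDerivAt (fun s => gradient (φ s) (x + s • v₀))
      (deriv (fun r => gradient (φ r) (x + s • v₀)) s
        + fderiv ℝ (gradient (φ s)) (x + s • v₀) v₀) s := by
    intro s hs
    have hsT : s ∈ Ioo 0 T := ⟨hs.1, hs.2.trans ht₁⟩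
    have h1 : HasFDerivAt V (fderiv ℝ V (s, x + s • v₀)) (s, x + s • v₀) :=
      (((hV.mono (prod_mono Ioo_subset_Ico_self subset_rfl)).contDiffAt
        (prod_univ_mem_nhds hsT _)).differentiableAt one_ne_zero).hasFDerivAt
    have h2 : HasDerivAt (fun s : ℝ => (s, x + s • v₀)) (1, v₀) s := by
      refine (hasDerivAt_id s).prodMk ?_
      simpa using ((hasDerivAt_id s).smul_const v₀).const_add x
    have h3 := HasFDerivAt.comp_hasDerivAt (f := fun s : ℝ => (s, x + s • v₀)) s h1 h2
    have h4 : deriv (fun r => gradient (φ r) (x + s • v₀)) s = fderiv ℝ V (s, x + s • v₀) (1, 0) :=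
      h1.slice_left.deriv
    have h5 : fderiv ℝ (gradient (φ s)) (x + s • v₀) = _ := h1.slice_right.fderiv
    refine h3.congr_deriv ?_
    rw [h4, h5, ContinuousLinearMap.comp_apply, ← map_add]
    simp
  -- No characteristic ODE is solved: the velocity along the candidate straight line is compared
  -- with `v₀`. The difference `u` satisfies `⟪u, u'⟫ = -⟪u, D u⟫` with `‖D‖ ≤ C`, and starts at
  -- zero.
  have hQ := nonpos_of_deriv_le_mul (b := t₁) (C := 2 * C)
    (Q := fun s => ‖gradient (φ s) (x + s • v₀) - v₀‖ ^ 2) ?_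
    (fun s hs => ((hd s hs).sub_const v₀).norm_sq) ?_ ?_ ⟨ht.1, htt₁⟩
  · have := le_antisymm hQ (by positivity)
    exact sub_eq_zero.1 (norm_eq_zero.1 (pow_eq_zero_iff two_ne_zero |>.1 this))
  · refine ((ContinuousOn.sub ?_ continuousOn_const).norm).pow 2
    exact hV.continuousOn.comp hcont.continuousOn (hcurve t₁ ht₁.le)
  · intro s hs
    have hsT : s ∈ Ioo 0 T := ⟨hs.1, hs.2.trans ht₁⟩
    have hsI : s ∈ Ico 0 T := Ioo_subset_Ico_self hsT
    set X := x + s • v₀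
    set D := fderiv ℝ (gradient (φ s)) X
    set u := gradient (φ s) X - v₀
    have hρs : fderiv ℝ (ρ s) X = 0 := by
      rw [show ρ s = fun _ => 0 from funext (hρ s hsI)]
      simp
    have e1 : inner ℝ u (deriv (fun r => gradient (φ r) X) s) = -inner ℝ u (D (gradient (φ s) X)) := by
      rw [real_inner_comm, h.inner_deriv_velocity hsT, hρs, real_inner_comm,
        h.inner_fderiv_velocity_comm hsI, real_inner_comm]
      simp [D]
    have e2 : inner ℝ u (deriv (fun r => gradient (φ r) X) s + D v₀) = -inner ℝ u (D u) := by
      rw [inner_add_right, e1]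
      simp only [u, map_sub, inner_sub_right]
      ring
    have e3 : -inner ℝ u (D u) ≤ C * ‖u‖ ^ 2 := by
      have hDC : ‖D‖ ≤ C := hC s ⟨hs.1.le, hs.2.le⟩
      calc -inner ℝ u (D u) ≤ ‖u‖ * ‖D u‖ := (neg_le_abs _).trans (abs_real_inner_le_norm _ _)
        _ ≤ ‖u‖ * (C * ‖u‖) := by
          gcongr
          exact (D.le_opNorm u).trans (by gcongr)
        _ = C * ‖u‖ ^ 2 := by ring
    rw [e2]
    linarith
  · simp [v₀]

/-- The lifespan of a nontrivial flow without density. -/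
theorem lifespan_le_of_density_eq_zero (h : IsPotentialFlow σ T ρ φ) {R : ℝ}
    (hT : 0 < T) (hρ : ∀ t ∈ Ico 0 T, ∀ x, ρ t x = 0)
    (hsupp : ∀ t ∈ Ico 0 T, ∀ x, R < ‖x‖ → gradient (φ t) x = 0) {x : E}
    (hx : gradient (φ 0) x ≠ 0) : T ≤ 2 * R / ‖gradient (φ 0) x‖ := by
  have hn : 0 < ‖gradient (φ 0) x‖ := norm_pos_iff.2 hx
  have hle : ∀ t ∈ Ico 0 T, t ≤ 2 * R / ‖gradient (φ 0) x‖ := by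
    intro t ht
    have h1 : ‖x‖ ≤ R := by
      by_contra! hlt
      exact hx (hsupp 0 ⟨le_rfl, hT⟩ x hlt)
    have h2 : ‖x + t • gradient (φ 0) x‖ ≤ R := by
      by_contra! hlt
      have := hsupp t ht _ hlt
      rw [h.velocity_eq_of_density_eq_zero hρ ht] at this
      exact hx this
    rw [le_div_iff₀ hn]
    have h3 := norm_sub_le (x + t • gradient (φ 0) x) x
    rw [add_sub_cancel_left, norm_smul, Real.norm_of_nonneg ht.1] at h3
    linarith
  by_contra! hlt
  obtain ⟨t, h1, h2⟩ := exists_between (max_lt hT hlt)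
  exact absurd (hle t ⟨(le_max_left _ _).trans h1.le, h2⟩)
    (not_le.2 ((le_max_right _ _).trans_lt h1))

variable [MeasurableSpace E] [BorelSpace E]

/-- The lifespan of a flow of positive mass: `∫ φ` satisfies a Riccati inequality. -/
theorem lifespan_le_of_mass_pos [Nontrivial E] (h : IsPotentialFlow σ T ρ φ) (hσ : 1 ≤ σ)
    {R M : ℝ} (hR : 0 < R) (hM : 0 < M)
    (hsupp : ∀ t ∈ Ico 0 T, ∀ x ∉ Metric.closedBall (0 : E) R,
      ρ t x = 0 ∧ gradient (φ t) x = 0 ∧ φ t x = 0)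
    (hmass : ∫ x, ρ 0 x = M) :
    T ≤ Real.pi / √((M / volume.real (Metric.closedBall (0 : E) R)) ^ σ
      * volume.real (Metric.closedBall (0 : E) R)
      * (1 / (2 * (R ^ 2 * volume.real (Metric.closedBall (0 : E) R))))) := by
  set K := Metric.closedBall (0 : E) R
  have hK : IsCompact K := isCompact_closedBall 0 R
  have hk : 0 < volume.real K := by
    refine ENNReal.toReal_pos (Metric.measure_closedBall_pos volume _ hR).ne' hK.measure_lt_top.ne
  set k := volume.real K
  set m := M / k
  have hm : 0 < m := div_pos hM hk
  obtain ⟨e, he⟩ := exists_norm_eq E zero_le_one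
  refine lifespan_le_of_riccati (F := fun t => ∫ x, φ t x) (by positivity) (by positivity)
    (fun t ht => hasDerivAt_integral_slice (f := fun p : ℝ × E => φ p.1 p.2)
      ((h.contDiffOn_phase.of_le (by norm_num)).mono (prod_mono Ioo_subset_Ico_self subset_rfl)) hK
      (fun t ht x hx => (hsupp t (Ioo_subset_Ico_self ht) x hx).2.2) ht) ?_
  intro t ht
  have htI : t ∈ Ico 0 T := Ioo_subset_Ico_self ht
  have hφ : ContDiff ℝ 1 (φ t) := (h.contDiff_phase htI).of_le (by norm_num)
  have hρc : Continuous (ρ t) := (h.contDiff_density htI).continuous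
  have hvc : Continuous (gradient (φ t)) := (h.contDiff_velocity htI).continuous
  have hφs : HasCompactSupport (φ t) :=
    HasCompactSupport.intro hK fun x hx => (hsupp t htI x hx).2.2
  have hρi : Integrable (ρ t) := hρc.integrable_of_hasCompactSupport
    (HasCompactSupport.intro hK fun x hx => (hsupp t htI x hx).1)
  have hρM : ∫ x, ρ t x = M := by
    rw [h.integral_density hK (fun t ht x hx => (hsupp t ht x hx).1) htI, hmass]
  set F := ∫ x, φ t x
  set q : E → ℝ := fun x => inner ℝ x e * inner ℝ (gradient (φ t) x) e
  have hqi : Integrable q := by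
    refine Continuous.integrable_of_hasCompactSupport (by fun_prop)
      (HasCompactSupport.intro hK fun x hx => ?_)
    simp [q, (hsupp t htI x hx).2.1, -inner_gradient_left]
  -- The derivative of `(x·e) φ` along the unit vector `e` is `q + φ` and integrates to zero.
  have hq : ∫ x, q x = -F := by
    have h1 : ContDiff ℝ 1 fun x => inner ℝ x e * φ t x :=
      (contDiff_id.inner ℝ contDiff_const).mul hφ
    have h2 := integral_fderiv_apply_eq_zero h1 hφs.mul_left e
    have h3 : ∀ x, fderiv ℝ (fun x => inner ℝ x e * φ t x) x e = q x + φ t x := by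
      intro x
      have h4 : HasFDerivAt (fun x => inner ℝ x e * φ t x) _ x :=
        ((hasFDerivAt_id (𝕜 := ℝ) x).inner ℝ (hasFDerivAt_const e x)).mul
          (hφ.differentiable one_ne_zero x).hasFDerivAt
      rw [h4.fderiv]
      simp [q, he, inner_gradient_left]
    simp_rw [h3] at h2
    rw [integral_add hqi (hφ.continuous.integrable_of_hasCompactSupport hφs)] at h2
    linarith
  have hk1 : Integrable (K.indicator fun _ => (1 : ℝ)) :=
    (integrable_indicator_iff hK.measurableSet).2 (integrableOn_const hK.measure_lt_top.ne)
  have hk1' : ∫ x, K.indicator (fun _ => (1 : ℝ)) x = k := by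
    rw [integral_indicator_const _ hK.measurableSet]
    simp [k]
  -- The value minimizing `-μ F + μ² R² k / 2`, with minimum `-F² / (2 R² k)`. This is
  -- Cauchy–Schwarz in linearized form, which allows a pointwise estimate.
  set μ := F / (R ^ 2 * k)
  -- On `K`, the square of `μ (x·e) + (v·e)` being nonnegative bounds `-|v|²/2`, and the tangent
  -- line at `m` bounds `-ρ^σ`. Outside `K` both sides vanish.
  have hpt : ∀ x, deriv (fun s => φ s x) t ≤ μ * q x
      + (μ ^ 2 * R ^ 2 / 2 - m ^ σ + σ * m ^ σ) * K.indicator (fun _ => (1 : ℝ)) x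
      - σ * (m ^ σ / m) * ρ t x := by
    intro x
    rw [h.eikonal t ht]
    by_cases hx : x ∈ K
    · rw [indicator_of_mem hx]
      have h1 : |inner ℝ x e| ≤ R := by
        refine (abs_real_inner_le_norm x e).trans ?_
        rw [he, mul_one]
        simpa [K] using hx
      have h2 : |inner ℝ (gradient (φ t) x) e| ≤ ‖gradient (φ t) x‖ := by
        refine (abs_real_inner_le_norm _ _).trans ?_
        rw [he, mul_one]
      have h3 := sq_le_sq.2 (h1.trans (le_abs_self R))
      have h4 := sq_le_sq.2 (h2.trans (le_abs_self _))
      have h5 := mul_le_mul_of_nonneg_left h3 (sq_nonneg μ)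
      have h6 := sq_nonneg (μ * inner ℝ x e + inner ℝ (gradient (φ t) x) e)
      have h7 := pow_tangent_le (σ := σ) hm (h.nonneg t x)
      have h8 : σ * (m ^ σ / m) * (ρ t x - m) = σ * (m ^ σ / m) * ρ t x - σ * m ^ σ := by
        field_simp
      simp only [q]
      nlinarith only [h4, h5, h6, h7, h8]
    · obtain ⟨h1, h2, -⟩ := hsupp t htI x hx
      simp [q, hx, h1, h2, show σ ≠ 0 by omega, -inner_gradient_left]
  have hdi : Integrable fun x => deriv (fun s => φ s x) t := by
    simp_rw [h.eikonal t ht]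
    refine Continuous.integrable_of_hasCompactSupport (by fun_prop)
      (HasCompactSupport.intro hK fun x hx => ?_)
    obtain ⟨h1, h2, -⟩ := hsupp t htI x hx
    simp [h1, h2, show σ ≠ 0 by omega]
  have hI := integral_mono hdi (((hqi.const_mul μ).add (hk1.const_mul _)).sub
    (hρi.const_mul (σ * (m ^ σ / m)))) hpt
  refine hI.trans (le_of_eq ?_)
  rw [integral_sub' ((hqi.const_mul μ).add (hk1.const_mul _)) (hρi.const_mul _),
    integral_add' (hqi.const_mul μ) (hk1.const_mul _)]
  simp only [integral_const_mul]
  -- Since `m` is the mean density, the linear terms of the tangent line cancel on integration.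
  rw [hq, hk1', hρM, show M = m * k from (div_mul_cancel₀ M hk.ne').symm]
  simp only [μ]
  field_simp
  ring

end IsPotentialFlow

end Lifespan

/-! ### From the Cauchy problem to potential flows, and the uniform bound -/

section Main

variable {n σ : ℕ} {a₀ : EuclideanSpace ℝ (Fin n) → ℂ} {φ₀ : EuclideanSpace ℝ (Fin n) → ℝ}
  {a : ℝ → EuclideanSpace ℝ (Fin n) → ℂ} {φ : ℝ → EuclideanSpace ℝ (Fin n) → ℝ} {T : ℝ}

/-- Taking twice the real inner product of the transport equation with `a` gives the continuity
equation: the factor `1/2` in `a Δφ / 2` is exactly what makes `ρ Δφ` appear. -/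
theorem IsC2Solution.isPotentialFlow (h : IsC2Solution σ (Ico 0 T) a₀ φ₀ a φ) :
    IsPotentialFlow σ T (fun t x => ‖a t x‖ ^ 2) φ where
  contDiffOn_density := (h.contDiffOn_a.of_le (by norm_num)).norm_sq ℝ
  contDiffOn_phase := h.contDiffOn_φ
  nonneg t x := by positivity
  eikonal t ht x := by
    have h1 := h.eikonal t (Ioo_subset_Ico_self ht) x
    rw [derivWithin_of_mem_nhds (Ico_mem_nhds ht.1 ht.2), pow_mul] at h1
    linarith
  continuity t ht x := by
    have htI := Ioo_subset_Ico_self ht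
    have h1 := h.transport t htI x
    rw [derivWithin_of_mem_nhds (Ico_mem_nhds ht.1 ht.2)] at h1
    have hd : HasDerivAt (fun s => a s x) (deriv (fun s => a s x) t) t :=
      (hasDerivAt_slice (f := fun p : ℝ × EuclideanSpace ℝ (Fin n) => a p.1 p.2)
        ((h.contDiffOn_a.of_le (by norm_num)).mono (prod_mono Ioo_subset_Ico_self subset_rfl))
        ht x).differentiableAt.hasDerivAt
    have hs : ContDiff ℝ 2 (a t) :=
      h.contDiffOn_a.comp_contDiff (f := fun x => (t, x)) (by fun_prop) fun x => ⟨htI, mem_univ _⟩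
    have hx := ((hs.differentiable two_ne_zero) x).hasFDerivAt.norm_sq
    rw [hd.norm_sq.deriv, hx.fderiv]
    have h2 : deriv (fun s => a s x) t = -(fderiv ℝ (a t) x (gradient (φ t) x)
        + (1 / 2 * Laplacian.laplacian (φ t) x : ℝ) • a t x) := by
      rw [Complex.real_smul]
      push_cast
      linear_combination h1
    rw [h2, inner_neg_right, inner_add_right, real_inner_smul_right, real_inner_self_eq_norm_sq]
    simp
    ring

/-- The lifespan of a classical solution with nonzero data is bounded in terms of the data. -/
theorem exists_forall_lifespan_le (hn : 1 ≤ n) (hσ : 1 ≤ σ)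
    (ha₀ : ContDiff ℝ 2 a₀) (hφ₀ : ContDiff ℝ 2 φ₀)
    (ha₀c : HasCompactSupport a₀) (hφ₀c : HasCompactSupport φ₀) (hne : a₀ ≠ 0 ∨ φ₀ ≠ 0) :
    ∃ T₀ : ℝ, ∀ T, 0 < T → (∃ a φ, IsC2Solution σ (Ico 0 T) a₀ φ₀ a φ) → T ≤ T₀ := by
  have : Nonempty (Fin n) := ⟨⟨0, hn⟩⟩
  have : Nontrivial (EuclideanSpace ℝ (Fin n)) := inferInstance
  obtain ⟨R, hR, hRs⟩ : ∃ R : ℝ, 0 < R ∧ ∀ x, R < ‖x‖ → a₀ x = 0 ∧ φ₀ x = 0 := by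
    obtain ⟨R, hR⟩ := (ha₀c.isCompact.union hφ₀c.isCompact).isBounded.subset_closedBall 0
    refine ⟨max R 1, by positivity, fun x hx => ?_⟩
    have hx' : x ∉ tsupport a₀ ∪ tsupport φ₀ := fun hmem => by
      have := hR hmem
      rw [mem_closedBall_zero_iff] at this
      exact absurd ((le_max_left R 1).trans_lt hx) (not_lt.2 this)
    rw [mem_union, not_or] at hx'
    exact ⟨image_eq_zero_of_notMem_tsupport hx'.1, image_eq_zero_of_notMem_tsupport hx'.2⟩
  have hflow : ∀ (T : ℝ) a φ, IsC2Solution σ (Ico 0 T) a₀ φ₀ a φ → ∀ t ∈ Ico 0 T, ∀ x, R < ‖x‖ →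
      ‖a t x‖ ^ 2 = 0 ∧ gradient (φ t) x = 0 ∧ φ t x = 0 := by
    intro T a φ h t ht x hx
    exact h.isPotentialFlow.support_subset hσ
      (fun y hy => by simp [h.init_a, (hRs y hy).1])
      (fun y hy => by rw [h.init_φ, (hRs y hy).2]) ht hx
  have ha₀s : HasCompactSupport fun x => ‖a₀ x‖ ^ 2 :=
    ha₀c.comp_left (g := fun z : ℂ => ‖z‖ ^ 2) (by simp)
  by_cases ha : a₀ = 0
  -- Otherwise `φ₀` would be constant, hence zero by its value at a point outside the ball; such a
  -- point exists because `n ≥ 1`.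
  · obtain ⟨x, hx⟩ : ∃ x, gradient φ₀ x ≠ 0 := by
      by_contra! hcon
      have hconst := is_const_of_fderiv_eq_zero (𝕜 := ℝ) (hφ₀.differentiable two_ne_zero)
        fun x => by rw [← toDual_gradient, hcon x, map_zero]
      obtain ⟨y, hy⟩ := exists_norm_eq (EuclideanSpace ℝ (Fin n)) (add_pos hR one_pos).le
      refine hne.resolve_left (not_not.2 ha) (funext fun z => ?_)
      rw [hconst z y]
      exact (hRs y (by linarith)).2
    refine ⟨2 * R / ‖gradient φ₀ x‖, ?_⟩
    rintro T hT ⟨a, φ, h⟩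
    have h0 : φ 0 = φ₀ := funext h.init_φ
    rw [← h0] at hx ⊢
    refine h.isPotentialFlow.lifespan_le_of_density_eq_zero hT (fun t ht y => ?_)
      (fun t ht y hy => (hflow T a φ h t ht y hy).2.1) hx
    have hK := isCompact_closedBall (0 : EuclideanSpace ℝ (Fin n)) R
    have hout : ∀ t ∈ Ico 0 T, ∀ x ∉ Metric.closedBall (0 : EuclideanSpace ℝ (Fin n)) R,
        ‖a t x‖ ^ 2 = 0 := fun t ht x hx =>
      (hflow T a φ h t ht x (by simpa using hx)).1
    -- The conserved mass is zero, so the continuous nonnegative density vanishes at all times.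
    have hm := h.isPotentialFlow.integral_density hK hout ht
    simp only [h.init_a, ha] at hm
    have hz := ((h.isPotentialFlow.contDiff_density
      ht).continuous.integral_pos_of_hasCompactSupport_nonneg_nonzero (μ := volume) (x := y)
      (HasCompactSupport.intro hK (hout t ht)) (h.isPotentialFlow.nonneg t)).mt
      (not_lt.2 (by simp [hm]))
    exact not_ne_iff.1 hz
  · obtain ⟨x, hx⟩ := Function.ne_iff.1 ha
    have hM : 0 < ∫ x, ‖a₀ x‖ ^ 2 :=
      (ha₀.continuous.norm.pow 2).integral_pos_of_hasCompactSupport_nonneg_nonzero ha₀s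
        (fun x => by positivity) (x := x) (by simpa using hx)
    set K := Metric.closedBall (0 : EuclideanSpace ℝ (Fin n)) R
    refine ⟨Real.pi / √(((∫ x, ‖a₀ x‖ ^ 2) / volume.real K) ^ σ * volume.real K
      * (1 / (2 * (R ^ 2 * volume.real K)))), ?_⟩
    rintro T hT ⟨a, φ, h⟩
    refine h.isPotentialFlow.lifespan_le_of_mass_pos hσ hR hM
      (fun t ht x hx => hflow T a φ h t ht x (by simpa using hx)) ?_
    simp only [h.init_a]

theorem Ico_eventuallyEq_Ici {s t T : ℝ} (ht : t < T) : Ico s T =ᶠ[𝓝 t] Ici s := by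
  filter_upwards [Iio_mem_nhds ht] with r hr
  exact propext ⟨fun h => h.1, fun h => ⟨h, hr⟩⟩

theorem IsC2Solution.mono_Ici (h : IsC2Solution σ (Ici 0) a₀ φ₀ a φ) (T : ℝ) :
    IsC2Solution σ (Ico 0 T) a₀ φ₀ a φ where
  contDiffOn_a := h.contDiffOn_a.mono (prod_mono Ico_subset_Ici_self subset_rfl)
  contDiffOn_φ := h.contDiffOn_φ.mono (prod_mono Ico_subset_Ici_self subset_rfl)
  eikonal t ht x := by
    rw [derivWithin_congr_set (Ico_eventuallyEq_Ici ht.2)]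
    exact h.eikonal t ht.1 x
  transport t ht x := by
    rw [derivWithin_congr_set (Ico_eventuallyEq_Ici ht.2)]
    exact h.transport t ht.1 x
  init_a := h.init_a
  init_φ := h.init_φ

end Main

end

theorem mainTheorem9 (n σ : ℕ) (hn : 1 ≤ n) (hσ : 1 ≤ σ)
    (a₀ : EuclideanSpace ℝ (Fin n) → ℂ) (φ₀ : EuclideanSpace ℝ (Fin n) → ℝ)
    (ha₀ : ContDiff ℝ 2 a₀) (hφ₀ : ContDiff ℝ 2 φ₀)
    (ha₀c : HasCompactSupport a₀) (hφ₀c : HasCompactSupport φ₀)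
    (hne : a₀ ≠ 0 ∨ φ₀ ≠ 0) :
    (¬ ∃ (a : ℝ → EuclideanSpace ℝ (Fin n) → ℂ) (φ : ℝ → EuclideanSpace ℝ (Fin n) → ℝ),
        IsC2Solution σ (Ici 0) a₀ φ₀ a φ) ∧
    classicalLifespan σ a₀ φ₀ < ⊤ ∧
    (ContDiff ℝ ∞ a₀ → ContDiff ℝ ∞ φ₀ → sobolevLifespan σ a₀ φ₀ < ⊤) := by
  obtain ⟨T₀, hT₀⟩ := exists_forall_lifespan_le hn hσ ha₀ hφ₀ ha₀c hφ₀c hne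
  have hlife : classicalLifespan σ a₀ φ₀ < ⊤ :=
    (iSup₂_le fun T hT => ENNReal.ofReal_le_ofReal (hT₀ T hT.1 hT.2)).trans_lt
      (ENNReal.ofReal_lt_top (r := T₀))
  refine ⟨?_, hlife, fun _ _ => lt_of_le_of_lt ?_ hlife⟩
  · rintro ⟨a, φ, h⟩
    -- The sign of `T₀` is not known; this time is both positive and beyond `T₀`.
    have h1 : (0 : ℝ) < max T₀ 0 + 1 := by positivity
    have := hT₀ _ h1 ⟨a, φ, h.mono_Ici _⟩
    linarith [le_max_left T₀ 0]
  · refine iSup₂_le fun T hT => ?_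
    obtain ⟨hT0, a, φ, h, -⟩ := hT
    exact le_iSup₂_of_le T ⟨hT0, a, φ, h⟩ le_rfl
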